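/- Let $n\ge 1$, let $\mathbf H$ be the real quaternions, $M(n,\mathbf H)$ the ring of $n\times n$ matrices over $\mathbf H$, and $A^*=(a^*_{ij})$, $a^*_{ij}=\overline{a_{ji}}$, the conjugate transpose of $A=(a_{ij})\in M(n,\mathbf H)$. For $B=(b_{ij})\in M(n,\mathbf H)$ the $i$-th row determinant is $$\mathrm{rdet}_i B=\sum_{\sigma\in S_n}\operatorname{sgn}(\sigma)\, b_{x_1\sigma(x_1)}b_{x_2\sigma(x_2)}\cdots b_{x_n\sigma(x_n)},$$ where $x_1,\dots,x_n$ (depending on $\sigma$ and $i$) lists the indices cycle by cycle, each cycle being written as $x,\sigma(x),\sigma^2(x),\dots$; the first cycle is the one containing $i$ and starts with $i$, every other cycle (fixed points included) starts with its least element, and these least elements increase from one cycle to the next. The $j$-th column determinant is $$\mathrm{cdet}_j B=\sum_{\sigma\in S_n}\operatorname{sgn}(\sigma)\, b_{\sigma(x_n)x_n}\cdots b_{\sigma(x_2)x_2}b_{\sigma(x_1)x_1},$$ with $x_1,\dots,x_n$ the same list for $i=j$. If $B$ is Hermitian, $\det B$ denotes the common (real) value of all $\mathrm{rdet}_iB$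 and $\mathrm{cdet}_jB$. Put $\mathrm{ddet}\,A=\det(A^*A)=\det(AA^*)$. The left and right double cofactors of $A$ are $$\mathbb L_{ij}=\mathrm{cdet}_j\big((A^*A)_{.j}(a^*_{.i})\big),\qquad \mathbb R_{ij}=\mathrm{rdet}_i\big((AA^*)_{i.}(a^*_{j.})\big),$$ where $B_{.j}(c)$ (resp. $B_{i.}(c)$) is $B$ with its $j$-th column (resp. $i$-th row) replaced by $c$, and $a^*_{.i}$, $a^*_{j.}$ are the $i$-th column and the $j$-th row of $A^*$. **Theorem 8.1.** Let $A\in M(n,\mathbf H)$. The number $\mathrm{ddet}\,A$ is well defined and real, i.e. for all $i$ the values $\mathrm{rdet}_i(A^*A)$, $\mathrm{cdet}_i(A^*A)$, $\mathrm{rdet}_i(AA^*)$, $\mathrm{cdet}_i(AA^*)$ all equal one and the same real number; in particular $\mathrm{ddet}\,A^*=\mathrm{ddet}\,A$. For all $j$ and all $i$ respectively, $$\mathrm{ddet}\,A=\sum_{i}\mathbb L_{ij}\,a_{ij},\qquad \mathrm{ddet}\,A=\sum_{j}a_{ij}\,\mathbb R_{ij}.$$ The matrix $A$ is invertible if and only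 if $\mathrm{ddet}\,A\ne0$. In that case $A^*A$ and $AA^*$ are invertible and $$A^{-1}=(A^*A)^{-1}A^*=\frac1{\mathrm{ddet}\,A}\,(\mathbb L_{ij})^T,\qquad A^{-1}=A^*(AA^*)^{-1}=\frac1{\mathrm{ddet}\,A^*}\,(\mathbb R_{ij})^T .$$ -/

import Mathlib

open scoped Matrix Quaternion

namespace QuatDet

variable {n : ℕ}

/-- The cycle of `σ` through `x`, written with `x` first: `[x, σ x, σ (σ x), …]`, each element of
the cycle occurring exactly once (so it is `[x]` when `x` is fixed). -/
noncomputable def cycleFrom (σ : Equiv.Perm (Fin n)) (x : Fin n) : List (Fin n) :=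
  List.iterate σ x (Function.minimalPeriod σ x)

/-- The indices that open the cycles of `σ`: first `i`, which opens its own cycle, and then, in
increasing order, the least elements of all the cycles (fixed points included) that do not
contain `i`. -/
def openers (σ : Equiv.Perm (Fin n)) (i : Fin n) : List (Fin n) :=
  i :: (List.finRange n).filter
    (fun x => ¬ σ.SameCycle i x ∧ ∀ y, σ.SameCycle x y → x ≤ y)

/-- All the indices `0, …, n - 1`, in the order in which they occur in the ordered cycle notation
of `σ` whose first cycle is opened by `i`. -/
noncomputable def cycleOrder (σ : Equiv.Perm (Fin n)) (i : Fin n) : List (Fin n) :=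
  (openers σ i).flatMap (cycleFrom σ)

/-- The `i`-th row determinant: the alternating sum over all permutations `σ` of the products
`a_{x₁ σ(x₁)} a_{x₂ σ(x₂)} ⋯ a_{xₙ σ(xₙ)}`, the factors being ordered from left to right by the
left-ordered cycle notation `x₁, x₂, …, xₙ` of `σ` that is opened by `i`. -/
noncomputable def rdet (i : Fin n) (A : Matrix (Fin n) (Fin n) ℍ[ℝ]) : ℍ[ℝ] :=
  ∑ σ : Equiv.Perm (Fin n),
    Equiv.Perm.sign σ • ((cycleOrder σ i).map fun x => A x (σ x)).prod

/-- The `j`-th column determinant: the same with factors ordered from right to left,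
`a_{σ(xₙ) xₙ} ⋯ a_{σ(x₂) x₂} a_{σ(x₁) x₁}`, where `x₁ = j`.  Here `σ` sends each index to its
left neighbour in the right-ordered cycle notation, i.e. it is the inverse of the permutation
`τ` with monomial `∏ a_{y τ(y)}`; it runs over the same group and has the same sign. -/
noncomputable def cdet (j : Fin n) (A : Matrix (Fin n) (Fin n) ℍ[ℝ]) : ℍ[ℝ] :=
  ∑ σ : Equiv.Perm (Fin n),
    Equiv.Perm.sign σ • ((cycleOrder σ j).map fun x => A (σ x) x).reverse.prod

/-- The determinant of a Hermitian matrix `H` of size `n ≥ 1`: the common value of all its row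
and column determinants, read off at the first row.  Used for Hermitian `H` only. -/
noncomputable def hermDet [NeZero n] (H : Matrix (Fin n) (Fin n) ℍ[ℝ]) : ℍ[ℝ] :=
  rdet 0 H

/-- The double determinant `det (A* A)`. -/
noncomputable def ddet [NeZero n] (A : Matrix (Fin n) (Fin n) ℍ[ℝ]) : ℍ[ℝ] :=
  hermDet (Aᴴ * A)

/-- The left double cofactors: entry `(i, j)` is `cdet_j` of the matrix obtained from `A* A` by
replacing its `j`-th column with the `i`-th column of `A*`. -/
noncomputable def leftDoubleCofactor (A : Matrix (Fin n) (Fin n) ℍ[ℝ]) :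
    Matrix (Fin n) (Fin n) ℍ[ℝ] :=
  Matrix.of fun i j => cdet j ((Aᴴ * A).updateCol j fun k => Aᴴ k i)

/-- The right double cofactors: entry `(i, j)` is `rdet_i` of the matrix obtained from `A A*` by
replacing its `i`-th row with the `j`-th row of `A*`. -/
noncomputable def rightDoubleCofactor (A : Matrix (Fin n) (Fin n) ℍ[ℝ]) :
    Matrix (Fin n) (Fin n) ℍ[ℝ] :=
  Matrix.of fun i j => rdet i ((A * Aᴴ).updateRow i fun k => Aᴴ j k)

end QuatDet

/-!
The theorem rests on a normal form of the row and column determinants.  Let `B` be Hermitian away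
from its `i`-th row and column.  Inverting one cycle of `σ` that does not contain `i` leaves the sign
and the other cycles alone and conjugates the product along that cycle, so averaging over these
inversions replaces the product along every such cycle with its real part.  Real factors commute, and
hence `rdet i B` equals `traceDet i B`, the alternating sum of (product along the cycle of `i`) times
(real parts of the other products), as shown in `rdet_eq_traceDet`.  Passing from `σ` to `σ⁻¹` shows
that `star (traceDet i B) = traceDet i Bᴴ`, so `cdet i B` has the same value (`cdet_eq_traceDet`).
For Hermitian `B` the sum is therefore real, the cycle of `i` enters through its real part as well,
and no index is distinguished any more: this is `mooreDet B`.

The normal form is left linear in the row `i` and vanishes if this row equals another row `k`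
(`traceDet_eq_zero_of_row_eq`): multiplication by `swap i k` joins the cycles of `i` and `k`, or
splits their common cycle, and the terms cancel in pairs after one more averaging.  Applied to
`A Aᴴ`, whose rows are left combinations of the rows of `Aᴴ`, these two facts give
`A * Rᵀ = mooreDet (A * Aᴴ) • 1` for the matrix `R` of right double cofactors.  The left ones are
the conjugate transposes of the right ones of `Aᴴ`, which gives `Lᵀ * A = mooreDet (Aᴴ * A) • 1`.
The diagonal entries are the cofactor expansions, and a nonzero determinant makes `A` invertible.

The same two facts show that `H ↦ U * H * Uᴴ`, for `U` elementary, multiplies the determinants of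
Hermitian matrices by a nonzero real number, and `H ↦ Uᴴ * H * U` by the same number.  By Gaussian
elimination this holds for every invertible `U` (`scalesDet_of_isUnit`).  With `H = 1` it follows
that `mooreDet (A * Aᴴ) = mooreDet (Aᴴ * A) ≠ 0` for invertible `A`, while for other `A` both
numbers vanish by the cofactor formulas.
-/

open scoped Matrix Quaternion

namespace QuatDet

variable {n : ℕ}

/-! ### Products along the cycles of a permutation -/

/-- The product `b_{x σ(x)} b_{σ(x) σ²(x)} ⋯` of the first `L` factors along the orbit of `x`. -/
noncomputable def walkProd (B : Matrix (Fin n) (Fin n) ℍ[ℝ]) (σ : Equiv.Perm (Fin n)) (L : ℕ)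
    (x : Fin n) : ℍ[ℝ] :=
  ((List.iterate σ x L).map fun y => B y (σ y)).prod

/-- The product of the entries of `B` along the whole cycle of `σ` that starts at `x`. -/
noncomputable def cycleProd (B : Matrix (Fin n) (Fin n) ℍ[ℝ]) (σ : Equiv.Perm (Fin n))
    (x : Fin n) : ℍ[ℝ] :=
  walkProd B σ (Function.minimalPeriod σ x) x

section Walks

variable {B B' : Matrix (Fin n) (Fin n) ℍ[ℝ]} {σ τ : Equiv.Perm (Fin n)} {x y : Fin n}

lemma walkProd_succ (B : Matrix (Fin n) (Fin n) ℍ[ℝ]) (σ : Equiv.Perm (Fin n)) (L : ℕ)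
    (x : Fin n) : walkProd B σ (L + 1) x = B x (σ x) * walkProd B σ L (σ x) := by
  simp [walkProd, List.iterate]

lemma walkProd_add (B : Matrix (Fin n) (Fin n) ℍ[ℝ]) (σ : Equiv.Perm (Fin n)) (k L : ℕ)
    (x : Fin n) : walkProd B σ (k + L) x = walkProd B σ k x * walkProd B σ L (σ^[k] x) := by
  simp [walkProd, List.iterate_add]

lemma walkProd_one (B : Matrix (Fin n) (Fin n) ℍ[ℝ]) (σ : Equiv.Perm (Fin n)) (x : Fin n) :
    walkProd B σ 1 x = B x (σ x) := by
  simp [walkProd, List.iterate]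

lemma walkProd_congr {L : ℕ} (hσ : ∀ t < L, τ (σ^[t] x) = σ (σ^[t] x))
    (hB : ∀ t < L, B' (σ^[t] x) (σ (σ^[t] x)) = B (σ^[t] x) (σ (σ^[t] x))) :
    walkProd B' τ L x = walkProd B σ L x := by
  induction L generalizing x with
  | zero => simp [walkProd, List.iterate]
  | succ L ih =>
    have h0 : τ x = σ x := hσ 0 (by omega)
    have h1 : B' x (σ x) = B x (σ x) := hB 0 (by omega)
    rw [walkProd_succ, walkProd_succ, h0, h1, ih]
    · intro t ht
      simpa [Function.iterate_succ_apply] using hσ (t + 1) (by omega)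
    · intro t ht
      simpa [Function.iterate_succ_apply] using hB (t + 1) (by omega)

/-- Walking backwards and taking conjugates reverses the order of the factors. -/
lemma walkProd_inv (B : Matrix (Fin n) (Fin n) ℍ[ℝ]) (σ : Equiv.Perm (Fin n)) (L : ℕ)
    (x : Fin n) : walkProd B σ⁻¹ L (σ^[L] x) = star (walkProd Bᴴ σ L x) := by
  induction L with
  | zero => simp [walkProd, List.iterate]
  | succ L ih =>
    have h : σ⁻¹ (σ^[L + 1] x) = σ^[L] x := by
      rw [Function.iterate_succ_apply']
      exact σ.symm_apply_apply _
    rw [walkProd_succ, h, ih, walkProd_add Bᴴ, walkProd_one, star_mul,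
      Function.iterate_succ_apply', Matrix.conjTranspose_apply, star_star]

lemma sameCycle_iterate (σ : Equiv.Perm (Fin n)) (t : ℕ) (x : Fin n) :
    σ.SameCycle x (σ^[t] x) :=
  ⟨t, by rw [Equiv.Perm.iterate_eq_pow, zpow_natCast]⟩

lemma exists_iterate_eq_of_sameCycle (h : σ.SameCycle x y) : ∃ t : ℕ, σ^[t] x = y := by
  obtain ⟨t, ht⟩ := h.exists_nat_pow_eq
  exact ⟨t, by rw [Equiv.Perm.iterate_eq_pow, ht]⟩

lemma mem_periodicPts_perm (σ : Equiv.Perm (Fin n)) (x : Fin n) :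
    x ∈ Function.periodicPts σ :=
  Function.Injective.mem_periodicPts σ.injective x

lemma minimalPeriod_perm_pos (σ : Equiv.Perm (Fin n)) (x : Fin n) :
    0 < Function.minimalPeriod σ x :=
  Function.minimalPeriod_pos_of_mem_periodicPts (mem_periodicPts_perm σ x)

lemma iterate_congr_of_cycle (h : ∀ y, σ.SameCycle x y → τ y = σ y) (t : ℕ) :
    τ^[t] x = σ^[t] x := by
  induction t with
  | zero => rfl
  | succ t ih =>
    rw [Function.iterate_succ_apply', ih, h _ (sameCycle_iterate σ t x),
      Function.iterate_succ_apply']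

lemma sameCycle_congr_of_cycle (h : ∀ y, σ.SameCycle x y → τ y = σ y) :
    τ.SameCycle x y ↔ σ.SameCycle x y := by
  constructor
  · intro hy
    obtain ⟨t, rfl⟩ := exists_iterate_eq_of_sameCycle hy
    rw [iterate_congr_of_cycle h]
    exact sameCycle_iterate σ t x
  · intro hy
    obtain ⟨t, rfl⟩ := exists_iterate_eq_of_sameCycle hy
    rw [← iterate_congr_of_cycle h]
    exact sameCycle_iterate τ t x

lemma cycleProd_congr (h : ∀ y, σ.SameCycle x y → τ y = σ y)
    (hB : ∀ y, σ.SameCycle x y → B' y (σ y) = B y (σ y)) :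
    cycleProd B' τ x = cycleProd B σ x := by
  have hp : Function.minimalPeriod τ x = Function.minimalPeriod σ x := by
    rw [Function.minimalPeriod_eq_minimalPeriod_iff]
    intro k
    rw [Function.IsPeriodicPt, Function.IsPeriodicPt, Function.IsFixedPt, Function.IsFixedPt,
      iterate_congr_of_cycle h]
  rw [cycleProd, cycleProd, hp]
  exact walkProd_congr (fun t _ => h _ (sameCycle_iterate σ t x))
    fun t _ => hB _ (sameCycle_iterate σ t x)

lemma cycleProd_inv (B : Matrix (Fin n) (Fin n) ℍ[ℝ]) (σ : Equiv.Perm (Fin n)) (x : Fin n) :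
    cycleProd B σ⁻¹ x = star (cycleProd Bᴴ σ x) := by
  have hp : Function.minimalPeriod (⇑σ⁻¹) x = Function.minimalPeriod σ x := by
    rw [Function.minimalPeriod_eq_minimalPeriod_iff]
    intro k
    rw [Function.IsPeriodicPt, Function.IsPeriodicPt, Function.IsFixedPt, Function.IsFixedPt,
      Equiv.Perm.iterate_eq_pow, Equiv.Perm.iterate_eq_pow, inv_pow, Equiv.Perm.inv_eq_iff_eq,
      eq_comm]
  have h := walkProd_inv B σ (Function.minimalPeriod σ x) x
  rw [Function.iterate_minimalPeriod] at h
  rw [cycleProd, hp, h, cycleProd]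

lemma cycleProd_eq_mul (B : Matrix (Fin n) (Fin n) ℍ[ℝ]) (σ : Equiv.Perm (Fin n)) (x : Fin n) :
    cycleProd B σ x = B x (σ x) * walkProd B σ (Function.minimalPeriod σ x - 1) (σ x) := by
  rw [← walkProd_succ, Nat.sub_add_cancel (minimalPeriod_perm_pos σ x), cycleProd]

/-- Moving the starting point along a cycle permutes the factors of its product cyclically,
which does not affect the real part. -/
lemma re_cycleProd_apply (B : Matrix (Fin n) (Fin n) ℍ[ℝ]) (σ : Equiv.Perm (Fin n))
    (x : Fin n) : (cycleProd B σ (σ x)).re = (cycleProd B σ x).re := by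
  have hL := minimalPeriod_perm_pos σ x
  have h : cycleProd B σ (σ x) =
      walkProd B σ (Function.minimalPeriod σ x - 1) (σ x) * B x (σ x) := by
    rw [cycleProd, Function.minimalPeriod_apply (mem_periodicPts_perm σ x)]
    obtain ⟨L, hm⟩ : ∃ L, Function.minimalPeriod σ x = L + 1 := ⟨_, (Nat.sub_add_cancel hL).symm⟩
    have hx : σ^[L] (σ x) = x := by
      rw [← Function.iterate_succ_apply, Nat.succ_eq_add_one, ← hm,
        Function.iterate_minimalPeriod]
    rw [hm, walkProd_add, hx, walkProd_one, Nat.add_sub_cancel]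
  rw [h, cycleProd_eq_mul]
  simp only [Quaternion.re_mul]
  ring

lemma re_cycleProd_of_sameCycle (B : Matrix (Fin n) (Fin n) ℍ[ℝ]) (h : σ.SameCycle x y) :
    (cycleProd B σ y).re = (cycleProd B σ x).re := by
  obtain ⟨t, rfl⟩ := exists_iterate_eq_of_sameCycle h
  induction t with
  | zero => rfl
  | succ t ih =>
    rw [Function.iterate_succ_apply', re_cycleProd_apply, ih (sameCycle_iterate σ t x)]

end Walks

/-! ### Merging two cycles -/

section Merge

variable {B : Matrix (Fin n) (Fin n) ℍ[ℝ]} {σ : Equiv.Perm (Fin n)} {i k : Fin n}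

lemma mul_swap_apply_of_ne {y : Fin n} (hi : y ≠ i) (hk : y ≠ k) :
    (σ * Equiv.swap i k) y = σ y := by
  rw [Equiv.Perm.mul_apply, Equiv.swap_apply_of_ne_of_ne hi hk]

lemma mul_swap_agree {x : Fin n} (hi : ¬ σ.SameCycle i x) (hk : ¬ σ.SameCycle k x) :
    ∀ y, σ.SameCycle x y → (σ * Equiv.swap i k) y = σ y := by
  intro y hy
  apply mul_swap_apply_of_ne
  · rintro rfl
    exact hi hy.symm
  · rintro rfl
    exact hk hy.symm

/-- After multiplication by `swap i k` the orbit of `i` follows the `σ`-cycle of `k`. -/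
lemma mul_swap_iterate (h : ¬ σ.SameCycle i k) {t : ℕ} (h0 : 0 < t)
    (ht : t ≤ Function.minimalPeriod σ k) : (σ * Equiv.swap i k)^[t] i = σ^[t] k := by
  induction t, h0 using Nat.le_induction with
  | base => simp
  | succ t h1 ih =>
    rw [Function.iterate_succ_apply', Function.iterate_succ_apply', ih (by omega)]
    apply mul_swap_apply_of_ne
    · intro hc
      exact h (hc ▸ sameCycle_iterate σ t k).symm
    · intro hc
      exact Function.not_isPeriodicPt_of_pos_of_lt_minimalPeriod (by omega) (by omega) hc

lemma mul_swap_iterate_minimalPeriod (h : ¬ σ.SameCycle i k) :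
    (σ * Equiv.swap i k)^[Function.minimalPeriod σ k] i = k := by
  rw [mul_swap_iterate h (minimalPeriod_perm_pos σ k) le_rfl, Function.iterate_minimalPeriod]

lemma walkProd_mul_swap (h : ¬ σ.SameCycle i k) (hB : B i = B k) :
    walkProd B (σ * Equiv.swap i k) (Function.minimalPeriod σ k) i = cycleProd B σ k := by
  have hL := minimalPeriod_perm_pos σ k
  rw [cycleProd_eq_mul, ← Nat.sub_add_cancel hL, walkProd_succ, Nat.add_sub_cancel, hB]
  have h1 : (σ * Equiv.swap i k) i = σ k := by simp
  rw [h1]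
  congr 1
  apply walkProd_congr
  · intro t ht
    rw [← Function.iterate_succ_apply]
    apply mul_swap_apply_of_ne
    · intro hc
      exact h (hc ▸ sameCycle_iterate σ _ k).symm
    · intro hc
      exact Function.not_isPeriodicPt_of_pos_of_lt_minimalPeriod (by omega) (by omega) hc
  · intro t ht
    rfl

lemma minimalPeriod_mul_swap (h : ¬ σ.SameCycle i k) :
    Function.minimalPeriod (σ * Equiv.swap i k) i =
      Function.minimalPeriod σ k + Function.minimalPeriod σ i := by
  have h' : ¬ σ.SameCycle k i := fun hc => h hc.symm
  have e : ∀ t, (σ * Equiv.swap i k)^[t + Function.minimalPeriod σ k] i =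
      (σ * Equiv.swap k i)^[t] k := by
    intro t
    rw [Function.iterate_add_apply, mul_swap_iterate_minimalPeriod h, Equiv.swap_comm]
  have hpos := minimalPeriod_perm_pos (σ * Equiv.swap i k) i
  apply le_antisymm
  · apply Function.IsPeriodicPt.minimalPeriod_le
    · have := minimalPeriod_perm_pos σ k
      omega
    · rw [Function.IsPeriodicPt, Function.IsFixedPt, add_comm, e,
        mul_swap_iterate_minimalPeriod h']
  · by_contra! hlt
    have hm := Function.iterate_minimalPeriod (f := ⇑(σ * Equiv.swap i k)) (x := i)
    rcases le_or_gt (Function.minimalPeriod (σ * Equiv.swap i k) i)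
      (Function.minimalPeriod σ k) with hle | hgt
    · rw [mul_swap_iterate h hpos hle] at hm
      exact h' (hm ▸ sameCycle_iterate σ _ k)
    · obtain ⟨t, ht⟩ := Nat.exists_eq_add_of_lt hgt
      have ht' : Function.minimalPeriod (σ * Equiv.swap i k) i =
          (t + 1) + Function.minimalPeriod σ k := by omega
      rw [ht', e, mul_swap_iterate h' (by omega) (by omega)] at hm
      exact Function.not_isPeriodicPt_of_pos_of_lt_minimalPeriod (by omega) (by omega) hm

/-- If the rows `i` and `k` of `B` coincide, then multiplying a permutation by `swap i k` joins
the product along the cycle of `k` and the product along the cycle of `i`, in this order. -/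
lemma cycleProd_mul_swap (h : ¬ σ.SameCycle i k) (hB : B i = B k) :
    cycleProd B (σ * Equiv.swap i k) i = cycleProd B σ k * cycleProd B σ i := by
  rw [cycleProd, minimalPeriod_mul_swap h, walkProd_add, walkProd_mul_swap h hB,
    mul_swap_iterate_minimalPeriod h, Equiv.swap_comm i k,
    walkProd_mul_swap (fun hc => h hc.symm) hB.symm]

lemma sameCycle_mul_swap (h : ¬ σ.SameCycle i k) : (σ * Equiv.swap i k).SameCycle i k := by
  have := sameCycle_iterate (σ * Equiv.swap i k) (Function.minimalPeriod σ k) i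
  rwa [mul_swap_iterate_minimalPeriod h] at this

/-- Multiplying by `swap i k` splits a cycle that contains both `i` and `k`. -/
lemma not_sameCycle_mul_swap (hik : i ≠ k) (h : σ.SameCycle i k) :
    ¬ (σ * Equiv.swap i k).SameCycle i k := by
  classical
  -- `a` is the least number of steps from `i` to `k`, so the `σ * swap i k`-orbit of `k` is
  -- `σ i, …, σ^a i = k`, which misses `i`.
  have hex := exists_iterate_eq_of_sameCycle h
  set a := Nat.find hex with ha
  have hak : σ^[a] i = k := Nat.find_spec hex
  have hmin : ∀ t < a, σ^[t] i ≠ k := fun t ht => Nat.find_min hex ht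
  have ha0 : 0 < a := by
    rcases Nat.eq_zero_or_pos a with h0 | h0
    · rw [h0] at hak
      exact absurd hak hik
    · exact h0
  have hne : ∀ t, 0 < t → t ≤ a → σ^[t] i ≠ i := by
    intro t h0 hta hc
    apply hmin (a - t) (by omega)
    have := hak
    rwa [← Nat.sub_add_cancel hta, Function.iterate_add_apply, hc] at this
  have horb : ∀ t, 0 < t → t ≤ a → (σ * Equiv.swap i k)^[t] k = σ^[t] i := by
    intro t h0
    induction t, h0 using Nat.le_induction with
    | base => simp
    | succ t h1 ih =>
      intro hta
      rw [Function.iterate_succ_apply', Function.iterate_succ_apply', ih (by omega)]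
      exact mul_swap_apply_of_ne (hne t (by omega) (by omega)) (hmin t (by omega))
  have hper : Function.IsPeriodicPt (σ * Equiv.swap i k) a k := by
    rw [Function.IsPeriodicPt, Function.IsFixedPt, horb a ha0 le_rfl, hak]
  intro hc
  obtain ⟨t, ht⟩ := exists_iterate_eq_of_sameCycle hc.symm
  rw [← hper.iterate_mod_apply] at ht
  rcases Nat.eq_zero_or_pos (t % a) with h0 | h0
  · rw [h0] at ht
    exact hik ht.symm
  · have hlt := Nat.mod_lt t ha0
    rw [horb _ h0 hlt.le] at ht
    exact hne _ h0 hlt.le ht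

lemma sameCycle_mul_swap_iff (h : ¬ σ.SameCycle i k) (x : Fin n) :
    (σ * Equiv.swap i k).SameCycle i x ↔ σ.SameCycle i x ∨ σ.SameCycle k x := by
  have hik := sameCycle_mul_swap h
  have hstep : ∀ y, (σ * Equiv.swap i k).SameCycle i y →
      (σ * Equiv.swap i k).SameCycle i (σ y) := by
    intro y hy
    by_cases h1 : y = i
    · have e : σ y = (σ * Equiv.swap i k) k := by simp [h1]
      rw [e, Equiv.Perm.sameCycle_apply_right]
      exact hik
    · by_cases h2 : y = k
      · have e : σ y = (σ * Equiv.swap i k) i := by simp [h2]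
        rw [e, Equiv.Perm.sameCycle_apply_right]
      · rw [← mul_swap_apply_of_ne h1 h2, Equiv.Perm.sameCycle_apply_right]
        exact hy
  constructor
  · intro hx
    by_contra! hc
    have := (sameCycle_congr_of_cycle (mul_swap_agree hc.1 hc.2)).1 hx.symm
    exact hc.1 this.symm
  · rintro (hx | hx) <;> obtain ⟨t, rfl⟩ := exists_iterate_eq_of_sameCycle hx
    · clear hx
      induction t with
      | zero => exact Equiv.Perm.SameCycle.refl _ _
      | succ t ih => rw [Function.iterate_succ_apply']; exact hstep _ ih
    · clear hx
      induction t with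
      | zero => exact hik
      | succ t ih => rw [Function.iterate_succ_apply']; exact hstep _ ih

end Merge

/-! ### Inverting one cycle -/

section Flip

/-- The permutation obtained from `σ` by inverting the cycle through `m`. -/
noncomputable def flipCycle (σ : Equiv.Perm (Fin n)) (m : Fin n) : Equiv.Perm (Fin n) :=
  σ * (σ.cycleOf m)⁻¹ * (σ.cycleOf m)⁻¹

variable {B : Matrix (Fin n) (Fin n) ℍ[ℝ]} {σ : Equiv.Perm (Fin n)} {m x y : Fin n}

lemma flipCycle_apply_of_sameCycle (h : σ.SameCycle m y) : flipCycle σ m y = σ⁻¹ y := by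
  have key : ∀ z, σ.SameCycle m z → (σ.cycleOf m)⁻¹ z = σ⁻¹ z := by
    intro z hz
    rw [Equiv.Perm.inv_eq_iff_eq, Equiv.Perm.SameCycle.cycleOf_apply]
    · exact (σ.apply_symm_apply z).symm
    · exact Equiv.Perm.sameCycle_symm_apply_right.2 hz
  rw [flipCycle, Equiv.Perm.mul_apply, Equiv.Perm.mul_apply, key y h, key]
  · exact σ.apply_symm_apply _
  · exact Equiv.Perm.sameCycle_symm_apply_right.2 h

lemma flipCycle_apply_of_not_sameCycle (h : ¬ σ.SameCycle m y) : flipCycle σ m y = σ y := by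
  have key : (σ.cycleOf m)⁻¹ y = y := by
    rw [Equiv.Perm.inv_eq_iff_eq, Equiv.Perm.cycleOf_apply_of_not_sameCycle h]
  rw [flipCycle, Equiv.Perm.mul_apply, Equiv.Perm.mul_apply, key, key]

lemma sign_flipCycle (σ : Equiv.Perm (Fin n)) (m : Fin n) :
    Equiv.Perm.sign (flipCycle σ m) = Equiv.Perm.sign σ := by
  rw [flipCycle, Equiv.Perm.sign_mul, Equiv.Perm.sign_mul, mul_assoc, Int.units_mul_self, mul_one]

lemma flipCycle_agree_inv (h : σ.SameCycle m x) :
    ∀ y, σ⁻¹.SameCycle x y → flipCycle σ m y = σ⁻¹ y := fun _ hy =>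
  flipCycle_apply_of_sameCycle (h.trans (Equiv.Perm.sameCycle_inv.1 hy))

lemma flipCycle_agree (h : ¬ σ.SameCycle m x) :
    ∀ y, σ.SameCycle x y → flipCycle σ m y = σ y := fun _ hy =>
  flipCycle_apply_of_not_sameCycle fun hc => h (hc.trans hy.symm)

lemma sameCycle_flipCycle : (flipCycle σ m).SameCycle x y ↔ σ.SameCycle x y := by
  by_cases h : σ.SameCycle m x
  · rw [sameCycle_congr_of_cycle (flipCycle_agree_inv h), Equiv.Perm.sameCycle_inv]
  · exact sameCycle_congr_of_cycle (flipCycle_agree h)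

lemma flipCycle_flipCycle (σ : Equiv.Perm (Fin n)) (m : Fin n) :
    flipCycle (flipCycle σ m) m = σ := by
  ext1 y
  by_cases h : σ.SameCycle m y
  · rw [flipCycle_apply_of_sameCycle (sameCycle_flipCycle.2 h), Equiv.Perm.inv_eq_iff_eq,
      flipCycle_apply_of_sameCycle]
    · exact (σ.symm_apply_apply y).symm
    · rwa [Equiv.Perm.sameCycle_apply_right]
  · rw [flipCycle_apply_of_not_sameCycle (fun hc => h (sameCycle_flipCycle.1 hc)),
      flipCycle_apply_of_not_sameCycle h]

lemma cycleProd_flipCycle_of_not_sameCycle (h : ¬ σ.SameCycle m x) :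
    cycleProd B (flipCycle σ m) x = cycleProd B σ x :=
  cycleProd_congr (flipCycle_agree h) fun _ _ => rfl

/-- Inverting a cycle on which `B` is Hermitian conjugates the product along it. -/
lemma cycleProd_flipCycle_self
    (hB : ∀ x y, σ.SameCycle m x → σ.SameCycle m y → Bᴴ x y = B x y) :
    cycleProd B (flipCycle σ m) m = star (cycleProd B σ m) := by
  rw [cycleProd_congr (flipCycle_agree_inv (Equiv.Perm.SameCycle.refl σ m)) fun _ _ => rfl,
    cycleProd_inv]
  congr 1
  refine cycleProd_congr (fun _ _ => rfl) fun y hy => hB _ _ hy ?_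
  rwa [Equiv.Perm.sameCycle_apply_right]

end Flip

/-! ### The trace form of the determinant -/

section Leaders

variable {B B' : Matrix (Fin n) (Fin n) ℍ[ℝ]} {σ τ : Equiv.Perm (Fin n)}

/-- `x` is the least element of its cycle. -/
def IsLeader (σ : Equiv.Perm (Fin n)) (x : Fin n) : Prop := ∀ y, σ.SameCycle x y → x ≤ y

open Classical in
/-- The product of the real parts of the products along those cycles of `σ` whose elements
satisfy `P`.  Each cycle is represented by its least element; `P` is only ever a predicate that
is constant on the cycles. -/
noncomputable def reCyclesProd (B : Matrix (Fin n) (Fin n) ℍ[ℝ]) (σ : Equiv.Perm (Fin n))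
    (P : Fin n → Prop) : ℝ :=
  ∏ x with P x ∧ IsLeader σ x, (cycleProd B σ x).re

lemma reCyclesProd_congr {P P' : Fin n → Prop} (hP : ∀ x, P' x ↔ P x)
    (hσ : ∀ x y, P x → (τ.SameCycle x y ↔ σ.SameCycle x y))
    (hB : ∀ x, P x → (cycleProd B' τ x).re = (cycleProd B σ x).re) :
    reCyclesProd B' τ P' = reCyclesProd B σ P := by
  unfold reCyclesProd
  apply Finset.prod_congr
  · ext x
    simp only [Finset.mem_filter, Finset.mem_univ, true_and, hP x]
    refine and_congr_right fun hx => ?_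
    simp only [IsLeader, hσ x _ hx]
  · intro x hx
    simp only [Finset.mem_filter] at hx
    exact hB x hx.2.1

/-- The factor of the cycle through `j` can be split off, and computed from `j` instead of the
least element of the cycle. -/
lemma reCyclesProd_eq_mul {P : Fin n → Prop} {j : Fin n}
    (hP : ∀ x, σ.SameCycle j x → P x) :
    reCyclesProd B σ P =
      (cycleProd B σ j).re * reCyclesProd B σ (fun x => P x ∧ ¬ σ.SameCycle j x) := by
  classical
  obtain ⟨m, hm, hmin⟩ := Finset.exists_min_image
    (Finset.univ.filter fun x => σ.SameCycle j x) id
    ⟨j, by simp [Equiv.Perm.SameCycle.refl]⟩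
  simp only [Finset.mem_filter, Finset.mem_univ, true_and, id] at hm hmin
  have hset : (Finset.univ.filter fun x => P x ∧ IsLeader σ x) =
      insert m (Finset.univ.filter fun x => (P x ∧ ¬ σ.SameCycle j x) ∧ IsLeader σ x) := by
    ext x
    simp only [Finset.mem_filter, Finset.mem_univ, true_and, Finset.mem_insert]
    constructor
    · rintro ⟨hx, hl⟩
      by_cases hj : σ.SameCycle j x
      · exact Or.inl (le_antisymm (hl m (hj.symm.trans hm)) (hmin x hj))
      · exact Or.inr ⟨⟨hx, hj⟩, hl⟩
    · rintro (rfl | hx)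
      · exact ⟨hP _ hm, fun y hy => hmin y (hm.trans hy)⟩
      · exact ⟨hx.1.1, hx.2⟩
  unfold reCyclesProd
  rw [hset, Finset.prod_insert fun h => (Finset.mem_filter.1 h).2.1.2 hm,
    re_cycleProd_of_sameCycle B hm]
  congr!

/-- The sum to which both the `i`-th row determinant and the `i`-th column determinant reduce
when `B` is Hermitian away from its `i`-th row and column: every cycle that does not contain `i`
enters through the real part of its product only. -/
noncomputable def traceDet (i : Fin n) (B : Matrix (Fin n) (Fin n) ℍ[ℝ]) : ℍ[ℝ] :=
  ∑ σ : Equiv.Perm (Fin n), Equiv.Perm.sign σ •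
    (cycleProd B σ i * (reCyclesProd B σ fun x => ¬ σ.SameCycle i x : ℝ))

/-- `B` is Hermitian away from its `i`-th row and `i`-th column. -/
def IsHermitianOff (i : Fin n) (B : Matrix (Fin n) (Fin n) ℍ[ℝ]) : Prop :=
  ∀ x y, x ≠ i → y ≠ i → Bᴴ x y = B x y

lemma IsHermitianOff.conjTranspose {i : Fin n} (h : IsHermitianOff i B) :
    IsHermitianOff i Bᴴ := by
  intro x y hx hy
  rw [Matrix.conjTranspose_conjTranspose, h x y hx hy]

lemma _root_.Matrix.IsHermitian.isHermitianOff (h : B.IsHermitian) (i : Fin n) :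
    IsHermitianOff i B := fun x y _ _ => by rw [h.eq]

lemma IsHermitianOff.updateRow {i : Fin n} (h : IsHermitianOff i B) (v : Fin n → ℍ[ℝ]) :
    IsHermitianOff i (B.updateRow i v) := by
  intro x y hx hy
  rw [Matrix.conjTranspose_apply, Matrix.updateRow_ne hx, Matrix.updateRow_ne hy]
  exact h x y hx hy

/-- Averaging over the inversion of the cycle through `m`. -/
lemma sum_filter_eq_of_add_flipCycle {m : Fin n} {Ω : Equiv.Perm (Fin n) → Prop}
    [DecidablePred Ω] {F G : Equiv.Perm (Fin n) → ℍ[ℝ]}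
    (hΩ : ∀ σ, Ω σ → Ω (flipCycle σ m))
    (h : ∀ σ, Ω σ → G σ + G (flipCycle σ m) = F σ + F σ) :
    ∑ σ with Ω σ, G σ = ∑ σ with Ω σ, F σ := by
  have h1 : ∑ σ with Ω σ, G σ = ∑ σ with Ω σ, G (flipCycle σ m) := by
    refine Finset.sum_nbij' (fun σ => flipCycle σ m) (fun σ => flipCycle σ m) ?_ ?_ ?_ ?_ ?_
    · intro σ hσ
      simp only [Finset.mem_filter, Finset.mem_univ, true_and] at hσ ⊢
      exact hΩ σ hσ
    · intro σ hσ
      simp only [Finset.mem_filter, Finset.mem_univ, true_and] at hσ ⊢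
      exact hΩ σ hσ
    · intro σ _
      exact flipCycle_flipCycle σ m
    · intro σ _
      exact flipCycle_flipCycle σ m
    · intro σ _
      rw [flipCycle_flipCycle]
  have h2 : (2 : ℝ) • ∑ σ with Ω σ, G σ = (2 : ℝ) • ∑ σ with Ω σ, F σ := by
    rw [two_smul, two_smul]
    conv_lhs => rw [h1]
    -- keep one copy as it is, and use the flipped sum for the other
    conv_lhs => arg 1; rw [← h1]
    rw [← Finset.sum_add_distrib, ← Finset.sum_add_distrib]
    refine Finset.sum_congr rfl fun σ hσ => h σ ?_
    simpa using hσ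
  exact smul_right_injective ℍ[ℝ] (two_ne_zero' ℝ) h2

/-- In an ordered product over a list without repetitions, one factor occupies one place. -/
lemma exists_list_prod_map_update {ι M : Type*} [DecidableEq ι] [Monoid M] {l : List ι}
    (hl : l.Nodup) {m : ι} (hm : m ∈ l) (g : ι → M) :
    ∃ p q : M, ∀ a : M, (l.map (Function.update g m a)).prod = p * a * q := by
  obtain ⟨s, t, rfl⟩ := List.append_of_mem hm
  have hs : m ∉ s := fun h => by
    simp only [List.nodup_append, List.mem_cons] at hl
    exact hl.2.2 m h m (Or.inl rfl) rfl
  have ht : m ∉ t := fun h => by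
    simp only [List.nodup_append, List.nodup_cons] at hl
    exact hl.2.1.1 h
  refine ⟨(s.map g).prod, (t.map g).prod, fun a => ?_⟩
  have h1 : s.map (Function.update g m a) = s.map g :=
    List.map_congr_left fun x hx => Function.update_of_ne (fun h => hs (by rwa [← h])) _ _
  have h2 : t.map (Function.update g m a) = t.map g :=
    List.map_congr_left fun x hx => Function.update_of_ne (fun h => ht (by rwa [← h])) _ _
  simp [h1, h2, mul_assoc]

lemma list_prod_map_filter {ι M : Type*} [Monoid M] (l : List ι) (p : ι → Prop)
    [DecidablePred p] (g : ι → M) :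
    ((l.filter fun x => p x).map g).prod = (l.map fun x => if p x then g x else 1).prod := by
  induction l with
  | nil => rfl
  | cons a l ih =>
    by_cases h : p a <;> simp [h, ih]

open Classical in
/-- The factor of `x` in the `σ`-term of the `i`-th row determinant, in which the products along
the cycles led by the elements of `S` have been replaced with their real parts. -/
noncomputable def leaderFactor (B : Matrix (Fin n) (Fin n) ℍ[ℝ]) (i : Fin n)
    (S : Finset (Fin n)) (σ : Equiv.Perm (Fin n)) (x : Fin n) : ℍ[ℝ] :=
  if ¬ σ.SameCycle i x ∧ IsLeader σ x then
    if x ∈ S then ((cycleProd B σ x).re : ℍ[ℝ]) else cycleProd B σ x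
  else 1

lemma rdet_eq_sum_leaderFactor (i : Fin n) (B : Matrix (Fin n) (Fin n) ℍ[ℝ]) :
    rdet i B = ∑ σ : Equiv.Perm (Fin n), Equiv.Perm.sign σ •
      (cycleProd B σ i * ((List.finRange n).map (leaderFactor B i ∅ σ)).prod) := by
  refine Finset.sum_congr rfl fun σ _ => ?_
  have h : ∀ l : List (Fin n), ((l.flatMap (cycleFrom σ)).map fun x => B x (σ x)).prod =
      (l.map (cycleProd B σ)).prod := by
    intro l
    induction l with
    | nil => rfl
    | cons a l ih =>
      rw [List.flatMap_cons, List.map_append, List.prod_append, ih, List.map_cons,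
        List.prod_cons]
      rfl
  rw [cycleOrder, h, openers, List.map_cons, List.prod_cons, list_prod_map_filter]
  congr 4
  ext1 x
  simp only [leaderFactor, Finset.notMem_empty, if_false]
  congr

/-- The cycles are replaced with their real parts one at a time: the step for the index `m`
concerns the permutations in which `m` leads a cycle without `i`, and averages over its flip. -/
lemma sum_leaderFactor_insert {i : Fin n} (hB : IsHermitianOff i B) (S : Finset (Fin n))
    (m : Fin n) :
    ∑ σ : Equiv.Perm (Fin n), Equiv.Perm.sign σ •
      (cycleProd B σ i * ((List.finRange n).map (leaderFactor B i S σ)).prod) =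
    ∑ σ : Equiv.Perm (Fin n), Equiv.Perm.sign σ •
      (cycleProd B σ i * ((List.finRange n).map (leaderFactor B i (insert m S) σ)).prod) := by
  classical
  by_cases hmS : m ∈ S
  · rw [Finset.insert_eq_of_mem hmS]
  rw [← Finset.sum_filter_add_sum_filter_not Finset.univ
      (fun σ : Equiv.Perm (Fin n) => ¬ σ.SameCycle i m ∧ IsLeader σ m),
    ← Finset.sum_filter_add_sum_filter_not Finset.univ
      (fun σ : Equiv.Perm (Fin n) => ¬ σ.SameCycle i m ∧ IsLeader σ m)
      (fun σ => Equiv.Perm.sign σ •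
      (cycleProd B σ i * ((List.finRange n).map (leaderFactor B i (insert m S) σ)).prod))]
  congr 1
  · apply sum_filter_eq_of_add_flipCycle (m := m)
    · intro σ hσ
      simpa only [IsLeader, sameCycle_flipCycle] using hσ
    · intro σ hσ
      obtain ⟨p, q, hpq⟩ := exists_list_prod_map_update (List.nodup_finRange n)
        (List.mem_finRange m) (leaderFactor B i S σ)
      have e1 : leaderFactor B i S σ =
          Function.update (leaderFactor B i S σ) m (cycleProd B σ m) := by
        symm
        rw [Function.update_eq_self_iff]
        simp [leaderFactor, hσ, hmS]
      have e2 : leaderFactor B i S (flipCycle σ m) =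
          Function.update (leaderFactor B i S σ) m (star (cycleProd B σ m)) := by
        ext1 x
        by_cases hx : x = m
        · subst hx
          have hl : IsLeader (flipCycle σ x) x := by
            simpa only [IsLeader, sameCycle_flipCycle] using hσ.2
          rw [Function.update_self, leaderFactor, if_pos ⟨by rw [sameCycle_flipCycle]; exact hσ.1,
            hl⟩, if_neg hmS, cycleProd_flipCycle_self]
          intro y z hy hz
          apply hB
          · rintro rfl
            exact hσ.1 hy.symm
          · rintro rfl
            exact hσ.1 hz.symm
        · rw [Function.update_of_ne hx]
          have hiff : (¬ (flipCycle σ m).SameCycle i x ∧ IsLeader (flipCycle σ m) x) ↔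
              ¬ σ.SameCycle i x ∧ IsLeader σ x := by
            simp only [IsLeader, sameCycle_flipCycle]
          by_cases hl : ¬ σ.SameCycle i x ∧ IsLeader σ x
          · rw [leaderFactor, leaderFactor, if_pos hl, if_pos (hiff.2 hl),
              cycleProd_flipCycle_of_not_sameCycle]
            intro hc
            exact hx (le_antisymm (hl.2 m hc.symm) (hσ.2 x hc))
          · rw [leaderFactor, leaderFactor, if_neg hl, if_neg (fun hc => hl (hiff.1 hc))]
      have e3 : leaderFactor B i (insert m S) σ =
          Function.update (leaderFactor B i S σ) m ((cycleProd B σ m).re : ℍ[ℝ]) := by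
        ext1 x
        by_cases hx : x = m
        · subst hx
          rw [Function.update_self, leaderFactor, if_pos hσ, if_pos (Finset.mem_insert_self x S)]
        · rw [Function.update_of_ne hx]
          simp [leaderFactor, hx]
      rw [e2, e3]
      conv_lhs => arg 1; rw [e1]
      rw [hpq, hpq, hpq, sign_flipCycle, cycleProd_flipCycle_of_not_sameCycle
        (fun hc => hσ.1 hc.symm), ← smul_add, ← smul_add, ← mul_add, ← mul_add, ← add_mul,
        ← add_mul, ← mul_add, ← mul_add, Quaternion.self_add_star, two_mul]
  · refine Finset.sum_congr rfl fun σ hσ => ?_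
    simp only [Finset.mem_filter, Finset.mem_univ, true_and] at hσ
    congr 4
    ext1 x
    by_cases hx : x = m
    · subst hx
      rw [leaderFactor, leaderFactor, if_neg hσ, if_neg hσ]
    · simp [leaderFactor, hx]

/-- Away from the cycle of `i`, the terms of `rdet i B` can be grouped with those of the
permutations that have some of the cycles inverted, and this replaces the products along these
cycles with their real parts. -/
theorem rdet_eq_traceDet {i : Fin n} (hB : IsHermitianOff i B) : rdet i B = traceDet i B := by
  classical
  have h : ∀ S : Finset (Fin n), rdet i B = ∑ σ : Equiv.Perm (Fin n), Equiv.Perm.sign σ •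
      (cycleProd B σ i * ((List.finRange n).map (leaderFactor B i S σ)).prod) := by
    intro S
    induction S using Finset.induction_on with
    | empty => exact rdet_eq_sum_leaderFactor i B
    | insert m S _ ih => rw [ih, sum_leaderFactor_insert hB S m]
  rw [h Finset.univ, traceDet]
  refine Finset.sum_congr rfl fun σ _ => ?_
  have hc : ∀ r : ℝ, (r : ℍ[ℝ]) = algebraMap ℝ ℍ[ℝ] r := fun _ => rfl
  congr 2
  unfold reCyclesProd
  rw [hc, Finset.prod_filter, Fin.prod_univ_def, map_list_prod, List.map_map]
  congr 2
  ext1 x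
  rw [Function.comp_apply, leaderFactor, apply_ite (algebraMap ℝ ℍ[ℝ]), map_one]
  simp [← hc]

lemma star_sign_smul (σ : Equiv.Perm (Fin n)) (q : ℍ[ℝ]) :
    star (Equiv.Perm.sign σ • q) = Equiv.Perm.sign σ • star q := by
  rcases Int.units_eq_one_or (Equiv.Perm.sign σ) with h | h <;> simp [h]

/-- Conjugation passes from `σ` to `σ⁻¹` and from `B` to `Bᴴ`. -/
theorem star_traceDet (i : Fin n) (B : Matrix (Fin n) (Fin n) ℍ[ℝ]) :
    star (traceDet i B) = traceDet i Bᴴ := by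
  rw [traceDet, star_sum, traceDet,
    ← Equiv.sum_comp (Equiv.inv (Equiv.Perm (Fin n))) (fun σ => Equiv.Perm.sign σ • _)]
  refine Finset.sum_congr rfl fun σ _ => ?_
  have h : reCyclesProd Bᴴ σ⁻¹ (fun x => ¬ σ⁻¹.SameCycle i x) =
      reCyclesProd B σ (fun x => ¬ σ.SameCycle i x) := by
    apply reCyclesProd_congr
    · intro x
      rw [Equiv.Perm.sameCycle_inv]
    · intro x y _
      rw [Equiv.Perm.sameCycle_inv]
    · intro x _
      rw [cycleProd_inv, Matrix.conjTranspose_conjTranspose, Quaternion.re_star]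
  rw [Equiv.inv_apply, Equiv.Perm.sign_inv, h, cycleProd_inv, Matrix.conjTranspose_conjTranspose,
    star_sign_smul, star_mul, Quaternion.star_coe, Quaternion.coe_commutes]

/-- The reversed order of the factors in `cdet` is that of the conjugate of a product in `rdet`. -/
lemma cdet_eq_star_rdet (j : Fin n) (B : Matrix (Fin n) (Fin n) ℍ[ℝ]) :
    cdet j B = star (rdet j Bᴴ) := by
  rw [cdet, rdet, star_sum]
  refine Finset.sum_congr rfl fun σ _ => ?_
  rw [star_sign_smul]
  congr 1
  induction cycleOrder σ j with
  | nil => simp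
  | cons a l ih => simp [ih, Matrix.conjTranspose_apply]

theorem cdet_eq_traceDet {i : Fin n} (hB : IsHermitianOff i B) : cdet i B = traceDet i B := by
  rw [cdet_eq_star_rdet, rdet_eq_traceDet hB.conjTranspose, star_traceDet,
    Matrix.conjTranspose_conjTranspose]

/-- For a Hermitian matrix the cycle of `i` contributes its real part only, too. -/
theorem traceDet_eq_sum_re (i : Fin n) (hB : B.IsHermitian) :
    traceDet i B =
      ((∑ σ : Equiv.Perm (Fin n), Equiv.Perm.sign σ • reCyclesProd B σ fun _ => True : ℝ) :
        ℍ[ℝ]) := by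
  have h1 : traceDet i B = ((traceDet i B).re : ℍ[ℝ]) := by
    rw [← Quaternion.star_eq_self, star_traceDet, hB.eq]
  have h2 : ∀ f : Equiv.Perm (Fin n) → ℍ[ℝ], (∑ σ, f σ).re = ∑ σ, (f σ).re := fun f =>
    map_sum (QuaternionAlgebra.reₗ (-1) 0 (-1) : ℍ[ℝ] →ₗ[ℝ] ℝ) f Finset.univ
  rw [h1, traceDet, h2]
  congr 1
  refine Finset.sum_congr rfl fun σ _ => ?_
  rw [Units.smul_def, Units.smul_def, Quaternion.re_smul, Quaternion.mul_coe_eq_smul,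
    Quaternion.re_smul, reCyclesProd_eq_mul (j := i) (fun _ _ => trivial), smul_eq_mul, mul_comm]
  simp only [true_and]

/-! ### Linearity in one row, and matrices with two equal rows -/

/-- The determinant is left linear in the distinguished row. -/
theorem traceDet_updateRow_sum {ι : Type*} (s : Finset ι) (i : Fin n)
    (B : Matrix (Fin n) (Fin n) ℍ[ℝ]) (c : ι → ℍ[ℝ]) (v : ι → Fin n → ℍ[ℝ]) :
    traceDet i (B.updateRow i fun y => ∑ j ∈ s, c j * v j y) =
      ∑ j ∈ s, c j * traceDet i (B.updateRow i (v j)) := by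
  -- the tail of the cycle of `i`, and the other cycles, do not see the row `i`
  have key : ∀ w : Fin n → ℍ[ℝ], traceDet i (B.updateRow i w) =
      ∑ σ : Equiv.Perm (Fin n), w (σ i) * (Equiv.Perm.sign σ •
        (walkProd B σ (Function.minimalPeriod σ i - 1) (σ i) *
          (reCyclesProd B σ fun x => ¬ σ.SameCycle i x : ℝ))) := by
    intro w
    refine Finset.sum_congr rfl fun σ _ => ?_
    have h1 : reCyclesProd (B.updateRow i w) σ (fun x => ¬ σ.SameCycle i x) =
        reCyclesProd B σ fun x => ¬ σ.SameCycle i x := by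
      refine reCyclesProd_congr (fun _ => Iff.rfl) (fun _ _ _ => Iff.rfl) fun x hx => ?_
      rw [cycleProd_congr (fun _ _ => rfl) fun y hy => ?_]
      rw [Matrix.updateRow_ne]
      rintro rfl
      exact hx hy.symm
    have h2 : walkProd (B.updateRow i w) σ (Function.minimalPeriod σ i - 1) (σ i) =
        walkProd B σ (Function.minimalPeriod σ i - 1) (σ i) := by
      refine walkProd_congr (fun _ _ => rfl) fun t ht => ?_
      rw [Matrix.updateRow_ne]
      rw [← Function.iterate_succ_apply]
      intro hc
      exact Function.not_isPeriodicPt_of_pos_of_lt_minimalPeriod (by omega) (by omega) hc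
    rw [cycleProd_eq_mul, h1, h2, Matrix.updateRow_self, mul_assoc, Units.smul_def,
      Units.smul_def, mul_smul_comm]
  rw [key]
  simp only [key, Finset.sum_mul, Finset.mul_sum, mul_assoc]
  exact Finset.sum_comm

/-- The terms in which `k` lies in the cycle of `i` cancel against those in which it does not:
multiplication by `swap i k` exchanges the two kinds and changes the sign, and it turns the
product `c_k c_i` along one cycle into the products `c_k` and `c_i` along two.  Of the former only
`Re c_k * c_i` survives, by averaging over the inversion of the cycle of `k`. -/
theorem traceDet_eq_zero_of_row_eq {i k : Fin n} (hik : i ≠ k) (hB : IsHermitianOff i B)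
    (hrow : B i = B k) : traceDet i B = 0 := by
  classical
  set R : Equiv.Perm (Fin n) → ℝ := fun σ =>
    reCyclesProd B σ fun x => ¬ σ.SameCycle i x ∧ ¬ σ.SameCycle k x
  have hsame : ∑ σ : Equiv.Perm (Fin n) with ¬ σ.SameCycle i k, Equiv.Perm.sign σ •
      (cycleProd B σ i * (reCyclesProd B σ fun x => ¬ σ.SameCycle i x : ℝ)) =
      ∑ σ : Equiv.Perm (Fin n) with ¬ σ.SameCycle i k, Equiv.Perm.sign σ •
        (((cycleProd B σ k).re : ℍ[ℝ]) * cycleProd B σ i * (R σ : ℝ)) := by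
    refine Finset.sum_congr rfl fun σ hσ => ?_
    simp only [Finset.mem_filter, Finset.mem_univ, true_and] at hσ
    rw [reCyclesProd_eq_mul (P := fun x => ¬ σ.SameCycle i x) (j := k)
      (fun x hx hc => hσ (hc.trans hx.symm)), Quaternion.coe_mul,
      ← mul_assoc, ← Quaternion.coe_commutes (cycleProd B σ k).re]
  have hdiff : ∑ σ : Equiv.Perm (Fin n) with ¬ ¬ σ.SameCycle i k, Equiv.Perm.sign σ •
      (cycleProd B σ i * (reCyclesProd B σ fun x => ¬ σ.SameCycle i x : ℝ)) =
      -∑ σ : Equiv.Perm (Fin n) with ¬ σ.SameCycle i k, Equiv.Perm.sign σ •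
        (cycleProd B σ k * cycleProd B σ i * (R σ : ℝ)) := by
    rw [← Finset.sum_neg_distrib]
    symm
    refine Finset.sum_nbij' (fun σ => σ * Equiv.swap i k) (fun σ => σ * Equiv.swap i k)
      ?_ ?_ ?_ ?_ ?_
    · intro σ hσ
      simp only [Finset.mem_filter, Finset.mem_univ, true_and, not_not] at hσ ⊢
      exact sameCycle_mul_swap hσ
    · intro σ hσ
      simp only [Finset.mem_filter, Finset.mem_univ, true_and, not_not] at hσ ⊢
      exact not_sameCycle_mul_swap hik hσ
    · intro σ _
      exact Equiv.mul_swap_mul_self i k σ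
    · intro σ _
      exact Equiv.mul_swap_mul_self i k σ
    · intro σ hσ
      simp only [Finset.mem_filter, Finset.mem_univ, true_and] at hσ
      have h : reCyclesProd B (σ * Equiv.swap i k)
          (fun x => ¬ (σ * Equiv.swap i k).SameCycle i x) = R σ := by
        apply reCyclesProd_congr
        · intro x
          rw [sameCycle_mul_swap_iff hσ, not_or]
        · intro x y hx
          exact sameCycle_congr_of_cycle (mul_swap_agree hx.1 hx.2)
        · intro x hx
          rw [cycleProd_congr (mul_swap_agree hx.1 hx.2) fun _ _ => rfl]
      rw [h, cycleProd_mul_swap hσ hrow, Equiv.Perm.sign_mul, Equiv.Perm.sign_swap hik,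
        mul_neg_one, Units.neg_smul]
  have hflip : ∑ σ : Equiv.Perm (Fin n) with ¬ σ.SameCycle i k, Equiv.Perm.sign σ •
        (cycleProd B σ k * cycleProd B σ i * (R σ : ℝ)) =
      ∑ σ : Equiv.Perm (Fin n) with ¬ σ.SameCycle i k, Equiv.Perm.sign σ •
        (((cycleProd B σ k).re : ℍ[ℝ]) * cycleProd B σ i * (R σ : ℝ)) := by
    apply sum_filter_eq_of_add_flipCycle (m := k)
    · intro σ hσ
      rwa [sameCycle_flipCycle]
    · intro σ hσ
      have h : R (flipCycle σ k) = R σ := by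
        apply reCyclesProd_congr
        · intro x
          simp only [sameCycle_flipCycle]
        · intro x y _
          exact sameCycle_flipCycle
        · intro x hx
          rw [cycleProd_flipCycle_of_not_sameCycle hx.2]
      have hk : cycleProd B (flipCycle σ k) k = star (cycleProd B σ k) := by
        apply cycleProd_flipCycle_self
        intro x y hx hy
        apply hB
        · rintro rfl
          exact hσ hx.symm
        · rintro rfl
          exact hσ hy.symm
      rw [h, hk, sign_flipCycle, cycleProd_flipCycle_of_not_sameCycle fun hc => hσ hc.symm,
        ← smul_add, ← smul_add, ← add_mul, ← add_mul, ← add_mul, ← add_mul,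
        Quaternion.self_add_star, two_mul]
  rw [traceDet, ← Finset.sum_filter_add_sum_filter_not Finset.univ
    (fun σ : Equiv.Perm (Fin n) => ¬ σ.SameCycle i k), hsame, hdiff, hflip, add_neg_cancel]

end Leaders

/-! ### The determinant of a Hermitian matrix -/

/-- The determinant of a Hermitian quaternionic matrix as a real number, in a form that singles
out no row: the alternating sum of the products of the real parts of the cycle products. -/
noncomputable def mooreDet (H : Matrix (Fin n) (Fin n) ℍ[ℝ]) : ℝ :=
  ∑ σ : Equiv.Perm (Fin n), Equiv.Perm.sign σ • reCyclesProd H σ fun _ => True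

section Hermitian

variable {A B H : Matrix (Fin n) (Fin n) ℍ[ℝ]}

lemma traceDet_eq_mooreDet (hH : H.IsHermitian) (i : Fin n) :
    traceDet i H = (mooreDet H : ℝ) :=
  traceDet_eq_sum_re i hH

theorem rdet_eq_mooreDet (hH : H.IsHermitian) (i : Fin n) : rdet i H = (mooreDet H : ℝ) := by
  rw [rdet_eq_traceDet (hH.isHermitianOff i), traceDet_eq_mooreDet hH]

theorem cdet_eq_mooreDet (hH : H.IsHermitian) (i : Fin n) : cdet i H = (mooreDet H : ℝ) := by
  rw [cdet_eq_traceDet (hH.isHermitianOff i), traceDet_eq_mooreDet hH]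

lemma mooreDet_one : mooreDet (1 : Matrix (Fin n) (Fin n) ℍ[ℝ]) = 1 := by
  classical
  rw [mooreDet, Finset.sum_eq_single 1]
  · rw [Equiv.Perm.sign_one, one_smul]
    apply Finset.prod_eq_one
    intro x _
    have hp : Function.minimalPeriod (⇑(1 : Equiv.Perm (Fin n))) x = 1 :=
      Function.minimalPeriod_eq_one_iff_isFixedPt.2 rfl
    rw [cycleProd, hp, walkProd_one]
    have hx : (1 : Matrix (Fin n) (Fin n) ℍ[ℝ]) x ((1 : Equiv.Perm (Fin n)) x) = 1 :=
      Matrix.one_apply_eq x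
    rw [hx, Quaternion.re_one]
  · intro σ _ hσ
    obtain ⟨x, hx⟩ : ∃ x, σ x ≠ x := by
      by_contra! h
      exact hσ (Equiv.ext h)
    rw [reCyclesProd_eq_mul (j := x) (fun _ _ => trivial), cycleProd_eq_mul,
      Matrix.one_apply_ne hx.symm]
    simp
  · simp

/-- Replacing the `i`-th row by the `k`-th one annihilates the determinant. -/
lemma traceDet_updateRow_of_ne (hB : IsHermitianOff i B) {k : Fin n} (hik : i ≠ k) :
    traceDet i (B.updateRow i (B k)) = 0 := by
  apply traceDet_eq_zero_of_row_eq hik (hB.updateRow _)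
  rw [Matrix.updateRow_ne hik.symm]
  exact Matrix.updateRow_self

/-- A row operation that changes only the distinguished row. -/
lemma traceDet_updateRow_add_smul {i j : Fin n} (hB : IsHermitianOff i B) (c : ℍ[ℝ]) :
    traceDet i (B.updateRow i (B i + c • B j)) = (1 + if i = j then c else 0) * traceDet i B := by
  have h := traceDet_updateRow_sum (Finset.univ : Finset (Fin 2)) i B ![1, c] ![B i, B j]
  simp only [Fin.sum_univ_two, Matrix.cons_val_zero, Matrix.cons_val_one, one_mul,
    Matrix.updateRow_eq_self] at h
  have e : (B i + c • B j) = fun y => B i y + c * B j y := rfl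
  rw [e, h, add_mul, one_mul]
  congr 1
  split_ifs with hij
  · rw [← hij, Matrix.updateRow_eq_self]
  · rw [traceDet_updateRow_of_ne hB hij, mul_zero, zero_mul]

lemma one_add_single_mul (i j : Fin n) (c : ℍ[ℝ]) (B : Matrix (Fin n) (Fin n) ℍ[ℝ]) :
    (1 + Matrix.single i j c) * B = B.updateRow i (B i + c • B j) := by
  ext1 x y
  rw [add_mul, one_mul, Matrix.add_apply]
  by_cases hx : x = i
  · subst hx
    rw [Matrix.single_mul_apply_same, Matrix.updateRow_self]
    rfl
  · rw [Matrix.single_mul_apply_of_ne _ _ _ _ _ hx, Matrix.updateRow_ne hx, add_zero]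

lemma conjTranspose_one_add_single (i j : Fin n) (c : ℍ[ℝ]) :
    (1 + Matrix.single i j c)ᴴ = 1 + Matrix.single j i (star c) := by
  rw [Matrix.conjTranspose_add, Matrix.conjTranspose_one, Matrix.conjTranspose_single]

/-- The effect on the determinant of an elementary row operation followed by the conjugate column
operation.  For `i ≠ j` this is a transvection, for `i = j` a dilation. -/
lemma mooreDet_elementary_congr (hH : H.IsHermitian) (i j : Fin n) (c : ℍ[ℝ]) :
    mooreDet ((1 + Matrix.single i j c) * H * (1 + Matrix.single i j c)ᴴ) =
      Quaternion.normSq (1 + if i = j then c else 0) * mooreDet H := by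
  set U : Matrix (Fin n) (Fin n) ℍ[ℝ] := 1 + Matrix.single i j c with hU
  have hUH : IsHermitianOff i (U * H) := by
    rw [hU, one_add_single_mul]
    exact (hH.isHermitianOff i).updateRow _
  have e : (U * H)ᴴ = H * Uᴴ := by rw [Matrix.conjTranspose_mul, hH.eq]
  have hB : IsHermitianOff i (H * Uᴴ) := e ▸ hUH.conjTranspose
  have h1 : traceDet i (U * H) = (1 + if i = j then c else 0) * (mooreDet H : ℝ) := by
    rw [hU, one_add_single_mul, traceDet_updateRow_add_smul (hH.isHermitianOff i),
      traceDet_eq_mooreDet hH]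
  have h2 : traceDet i (H * Uᴴ) = star (1 + if i = j then c else 0) * (mooreDet H : ℝ) := by
    rw [← e, ← star_traceDet, h1, star_mul, Quaternion.star_coe, Quaternion.coe_commutes]
  have h3 : traceDet i (U * (H * Uᴴ)) =
      (1 + if i = j then c else 0) * (star (1 + if i = j then c else 0) * (mooreDet H : ℝ)) := by
    rw [← h2, hU, one_add_single_mul, traceDet_updateRow_add_smul hB]
  rw [← mul_assoc, ← mul_assoc, Quaternion.self_mul_star, ← Quaternion.coe_mul,
    traceDet_eq_mooreDet (Matrix.isHermitian_mul_mul_conjTranspose U hH)] at h3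
  exact Quaternion.coe_injective h3

/-! ### Double cofactors -/

/-- The row `k` of `A Aᴴ` is the combination of the rows of `Aᴴ` with left coefficients `A k j`, so
the entry `(k, i)` of the product is the determinant of `A Aᴴ` with row `i` replaced by row `k`. -/
theorem mul_rightDoubleCofactor_transpose (A : Matrix (Fin n) (Fin n) ℍ[ℝ]) :
    A * (rightDoubleCofactor A)ᵀ = mooreDet (A * Aᴴ) • (1 : Matrix (Fin n) (Fin n) ℍ[ℝ]) := by
  have hH := Matrix.isHermitian_mul_conjTranspose_self A
  ext1 k i
  have h : (A * (rightDoubleCofactor A)ᵀ) k i =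
      traceDet i ((A * Aᴴ).updateRow i ((A * Aᴴ) k)) := by
    have e : (A * Aᴴ) k = fun y => ∑ j, A k j * Aᴴ j y := rfl
    rw [e, Matrix.mul_apply]
    refine Eq.trans ?_ (traceDet_updateRow_sum Finset.univ i (A * Aᴴ) (A k) Aᴴ).symm
    refine Finset.sum_congr rfl fun j _ => ?_
    rw [Matrix.transpose_apply, rightDoubleCofactor, Matrix.of_apply, rdet_eq_traceDet]
    exact (hH.isHermitianOff i).updateRow _
  rw [h, Matrix.smul_apply]
  by_cases hki : k = i
  · subst hki
    rw [Matrix.updateRow_eq_self, traceDet_eq_mooreDet hH, Matrix.one_apply_eq,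
      ← Quaternion.coe_mul_eq_smul, mul_one]
  · rw [traceDet_updateRow_of_ne (hH.isHermitianOff i) (Ne.symm hki), Matrix.one_apply_ne hki,
      smul_zero]

/-- The left double cofactors of `A` are the conjugate transposes of the right ones of `Aᴴ`. -/
lemma leftDoubleCofactor_apply_eq_star (A : Matrix (Fin n) (Fin n) ℍ[ℝ]) (i j : Fin n) :
    leftDoubleCofactor A i j = star (rightDoubleCofactor Aᴴ j i) := by
  rw [leftDoubleCofactor, rightDoubleCofactor, Matrix.of_apply, Matrix.of_apply,
    cdet_eq_star_rdet, ← Matrix.updateRow_conjTranspose,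
    (Matrix.isHermitian_conjTranspose_mul_self A).eq, Matrix.conjTranspose_conjTranspose]
  congr 3
  ext1 k
  simp

theorem leftDoubleCofactor_transpose_mul (A : Matrix (Fin n) (Fin n) ℍ[ℝ]) :
    (leftDoubleCofactor A)ᵀ * A = mooreDet (Aᴴ * A) • (1 : Matrix (Fin n) (Fin n) ℍ[ℝ]) := by
  have e : (leftDoubleCofactor A)ᵀ = ((rightDoubleCofactor Aᴴ)ᵀ)ᴴ := by
    ext1 i j
    rw [Matrix.transpose_apply, leftDoubleCofactor_apply_eq_star]
    rfl
  have h := congrArg Matrix.conjTranspose (mul_rightDoubleCofactor_transpose Aᴴ)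
  rw [Matrix.conjTranspose_mul, Matrix.conjTranspose_conjTranspose, ← e] at h
  rw [h]
  ext1 i j
  rw [Matrix.conjTranspose_apply, Matrix.smul_apply, Matrix.smul_apply, Quaternion.star_smul,
    ← Matrix.conjTranspose_apply, Matrix.conjTranspose_one]

lemma isUnit_of_mooreDet_mul_conjTranspose_ne_zero (h : mooreDet (A * Aᴴ) ≠ 0) : IsUnit A := by
  apply IsUnit.of_mul_eq_one ((mooreDet (A * Aᴴ))⁻¹ • (rightDoubleCofactor A)ᵀ)
  rw [mul_smul_comm, mul_rightDoubleCofactor_transpose, smul_smul, inv_mul_cancel₀ h, one_smul]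

/-! ### The determinant of a congruent matrix -/

/-- The congruences `H ↦ U H Uᴴ` and `H ↦ Uᴴ H U` multiply the determinants of all Hermitian
matrices by one and the same nonzero real number. -/
def ScalesDet (U : Matrix (Fin n) (Fin n) ℍ[ℝ]) : Prop :=
  ∃ r : ℝ, r ≠ 0 ∧ ∀ H : Matrix (Fin n) (Fin n) ℍ[ℝ], H.IsHermitian →
    mooreDet (U * H * Uᴴ) = r * mooreDet H ∧ mooreDet (Uᴴ * H * U) = r * mooreDet H

lemma ScalesDet.mooreDet_eq_and_ne_zero {U : Matrix (Fin n) (Fin n) ℍ[ℝ]} (h : ScalesDet U) :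
    mooreDet (U * Uᴴ) = mooreDet (Uᴴ * U) ∧ mooreDet (U * Uᴴ) ≠ 0 := by
  obtain ⟨r, hr, hU⟩ := h
  have h1 := hU 1 Matrix.isHermitian_one
  rw [mul_one, mul_one, mooreDet_one, mul_one] at h1
  exact ⟨h1.1.trans h1.2.symm, h1.1 ▸ hr⟩

lemma ScalesDet.isUnit {U : Matrix (Fin n) (Fin n) ℍ[ℝ]} (h : ScalesDet U) : IsUnit U :=
  isUnit_of_mooreDet_mul_conjTranspose_ne_zero h.mooreDet_eq_and_ne_zero.2

lemma scalesDet_one : ScalesDet (1 : Matrix (Fin n) (Fin n) ℍ[ℝ]) :=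
  ⟨1, one_ne_zero, fun H _ => by simp⟩

lemma scalesDet_one_add_single {i j : Fin n} {c : ℍ[ℝ]}
    (h : (1 + if i = j then c else 0) ≠ 0) : ScalesDet (1 + Matrix.single i j c) := by
  refine ⟨Quaternion.normSq (1 + if i = j then c else 0), ?_, fun H hH => ⟨?_, ?_⟩⟩
  · rwa [Ne, Quaternion.normSq_eq_zero]
  · exact mooreDet_elementary_congr hH i j c
  · have h1 := mooreDet_elementary_congr hH j i (star c)
    rw [conjTranspose_one_add_single, star_star] at h1
    rw [conjTranspose_one_add_single, h1, ← Quaternion.normSq_star]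
    congr 2
    rcases eq_or_ne i j with hij | hij
    · simp [hij]
    · simp [hij, hij.symm]

/-- A factor `E` that scales determinants can be cancelled. -/
lemma ScalesDet.of_mul {E A : Matrix (Fin n) (Fin n) ℍ[ℝ]} (hE : ScalesDet E)
    (hEA : ScalesDet (E * A)) : ScalesDet A := by
  obtain ⟨u, hu⟩ := hE.isUnit
  obtain ⟨r, hr, h⟩ := hE
  obtain ⟨s, hs, h'⟩ := hEA
  refine ⟨s / r, div_ne_zero hs hr, fun H hH => ⟨?_, ?_⟩⟩
  · have h1 := (h (A * H * Aᴴ) (Matrix.isHermitian_mul_mul_conjTranspose A hH)).1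
    have h2 := (h' H hH).1
    rw [Matrix.conjTranspose_mul] at h2
    have e : E * A * H * (Aᴴ * Eᴴ) = E * (A * H * Aᴴ) * Eᴴ := by simp only [mul_assoc]
    rw [e, h1] at h2
    field_simp
    linarith
  · -- `H` is itself of the form `Eᴴ K E`
    set V : Matrix (Fin n) (Fin n) ℍ[ℝ] := ↑u⁻¹ with hV
    have hVE : V * E = 1 := by rw [hV, ← hu, Units.inv_mul]
    have hEV : Eᴴ * Vᴴ = 1 := by
      rw [← Matrix.conjTranspose_mul, hVE, Matrix.conjTranspose_one]
    have hK := Matrix.isHermitian_conjTranspose_mul_mul V hH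
    have e1 : Eᴴ * (Vᴴ * H * V) * E = H := by
      calc Eᴴ * (Vᴴ * H * V) * E = (Eᴴ * Vᴴ) * H * (V * E) := by simp only [mul_assoc]
        _ = H := by rw [hEV, hVE, one_mul, mul_one]
    have h1 := (h _ hK).2
    have h2 := (h' _ hK).2
    rw [e1] at h1
    rw [Matrix.conjTranspose_mul] at h2
    have e2 : Aᴴ * Eᴴ * (Vᴴ * H * V) * (E * A) = Aᴴ * H * A := by
      calc _ = Aᴴ * (Eᴴ * (Vᴴ * H * V) * E) * A := by simp only [mul_assoc]
        _ = _ := by rw [e1]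
    rw [e2] at h2
    rw [h2, h1]
    field_simp

/-- The columns of `A` to the left of the column number `m` are those of the identity matrix. -/
def LeadingColsStandard (m : ℕ) (A : Matrix (Fin n) (Fin n) ℍ[ℝ]) : Prop :=
  ∀ x y : Fin n, (y : ℕ) < m → A x y = (1 : Matrix (Fin n) (Fin n) ℍ[ℝ]) x y

/-- Row operations with a row below the standard part do not disturb that part. -/
lemma LeadingColsStandard.one_add_single_mul {m : ℕ} (hA : LeadingColsStandard m A) {i j : Fin n}
    (hj : m ≤ (j : ℕ)) (c : ℍ[ℝ]) : LeadingColsStandard m ((1 + Matrix.single i j c) * A) := by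
  intro x y hy
  have hjy : j ≠ y := fun h => by omega
  rw [QuatDet.one_add_single_mul]
  by_cases hx : x = i
  · subst hx
    rw [Matrix.updateRow_self, Pi.add_apply, Pi.smul_apply, hA _ y hy, hA j y hy,
      Matrix.one_apply_ne hjy, smul_zero, add_zero]
  · rw [Matrix.updateRow_ne hx, hA x y hy]

lemma one_add_single_mul_apply_same (i j y : Fin n) (c : ℍ[ℝ])
    (B : Matrix (Fin n) (Fin n) ℍ[ℝ]) :
    ((1 + Matrix.single i j c) * B) i y = B i y + c * B j y := by
  rw [one_add_single_mul, Matrix.updateRow_self]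
  rfl

lemma one_add_single_mul_apply_of_ne {i x : Fin n} (hx : x ≠ i) (j y : Fin n) (c : ℍ[ℝ])
    (B : Matrix (Fin n) (Fin n) ℍ[ℝ]) : ((1 + Matrix.single i j c) * B) x y = B x y := by
  rw [one_add_single_mul, Matrix.updateRow_ne hx]

/-- Clearing a column with a pivot `1`, one entry at a time. -/
lemma scalesDet_of_pivot_one {c : Fin n}
    (ih : ∀ A : Matrix (Fin n) (Fin n) ℍ[ℝ], IsUnit A → LeadingColsStandard (c + 1) A →
      ScalesDet A) (s : Finset (Fin n)) (hcs : c ∉ s) :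
    ∀ A : Matrix (Fin n) (Fin n) ℍ[ℝ], IsUnit A → LeadingColsStandard c A → A c c = 1 →
      (∀ x, x ∉ s → x ≠ c → A x c = 0) → ScalesDet A := by
  induction s using Finset.induction_on with
  | empty =>
    intro A hA hst hcc h0
    refine ih A hA fun x y hy => ?_
    rcases Nat.lt_succ_iff_lt_or_eq.1 hy with hy | hy
    · exact hst x y hy
    · obtain rfl : y = c := Fin.ext hy
      by_cases hx : x = y
      · rw [hx, hcc, Matrix.one_apply_eq]
      · rw [h0 x (Finset.notMem_empty x) hx, Matrix.one_apply_ne hx]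
  | insert m s hm ihs =>
    intro A hA hst hcc h0
    have hmc : m ≠ c := fun h => hcs (h ▸ Finset.mem_insert_self m s)
    have hE : ScalesDet (1 + Matrix.single m c (-A m c)) :=
      scalesDet_one_add_single (by simp [hmc])
    refine hE.of_mul (ihs (fun h => hcs (Finset.mem_insert_of_mem h)) _ (hE.isUnit.mul hA)
      (hst.one_add_single_mul le_rfl _) ?_ ?_)
    · rw [one_add_single_mul_apply_of_ne hmc.symm, hcc]
    · intro x hx hxc
      by_cases hxm : x = m
      · subst hxm
        rw [one_add_single_mul_apply_same, hcc, mul_one, add_neg_cancel]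
      · rw [one_add_single_mul_apply_of_ne hxm]
        exact h0 x (by simp [hxm, hx]) hxc

lemma exists_ne_zero_below {c : Fin n} (hA : IsUnit A) (hst : LeadingColsStandard c A) :
    ∃ i, c ≤ i ∧ A i c ≠ 0 := by
  by_contra! h
  obtain ⟨u, rfl⟩ := hA
  -- otherwise the column `c` is a combination of the columns to the left of it
  set w : Fin n → ℍ[ℝ] := fun j => if j = c then 1 else if j < c then -u.1 j c else 0 with hw
  have hz : (u : Matrix (Fin n) (Fin n) ℍ[ℝ]) *ᵥ w = 0 := by
    ext1 x
    have hterm : ∀ j, u.1 x j * w j =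
        (if j = c then u.1 x c else 0) + (if j = x then (if x < c then -u.1 x c else 0) else 0) := by
      intro j
      simp only [hw]
      by_cases hj : j = c
      · subst hj
        by_cases hx : j = x
        · simp [hx]
        · simp [hx]
      · by_cases hlt : j < c
        · rw [hst x j hlt, if_neg hj, if_neg hj, if_pos hlt]
          by_cases hx : j = x
          · subst hx
            simp [hlt]
          · simp [Matrix.one_apply_ne (Ne.symm hx), hx]
        · rw [if_neg hj, if_neg hj, if_neg hlt]
          by_cases hx : j = x
          · subst hx
            simp [hlt]
          · simp [hx]
    rw [Matrix.mulVec, dotProduct, Finset.sum_congr rfl fun j _ => hterm j,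
      Finset.sum_add_distrib, Finset.sum_ite_eq', Finset.sum_ite_eq']
    by_cases hx : x < c
    · simp [hx]
    · simp [hx, h x (not_lt.1 hx)]
  have hw0 : w = 0 := by
    have := congrArg (fun v => (u⁻¹).1 *ᵥ v) hz
    simpa [Matrix.mulVec_mulVec] using this
  have := congrFun hw0 c
  simp [hw] at this

/-- Gaussian elimination by row operations, column by column: every invertible matrix is a product
of elementary ones. -/
theorem scalesDet_of_isUnit (hA : IsUnit A) : ScalesDet A := by
  have main : ∀ k : ℕ, ∀ A : Matrix (Fin n) (Fin n) ℍ[ℝ], IsUnit A →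
      LeadingColsStandard (n - k) A → ScalesDet A := by
    intro k
    induction k with
    | zero =>
      intro A _ hst
      have : A = 1 := by
        ext1 x y
        exact hst x y (by omega)
      rw [this]
      exact scalesDet_one
    | succ k ih =>
      intro A hA hst
      by_cases hk : n ≤ k
      · exact ih A hA fun x y hy => by omega
      · push Not at hk
        obtain ⟨c, hc⟩ : ∃ c : Fin n, (c : ℕ) = n - (k + 1) := ⟨⟨n - (k + 1), by omega⟩, rfl⟩
        rw [← hc] at hst
        have hk' : n - k = c + 1 := by omega
        rw [hk'] at ih
        have pivot : ∀ A : Matrix (Fin n) (Fin n) ℍ[ℝ], IsUnit A → LeadingColsStandard c A →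
            A c c ≠ 0 → ScalesDet A := by
          intro A hA hst hcc
          -- the dilation that divides the row `c` by the pivot
          have hE : ScalesDet (1 + Matrix.single c c ((A c c)⁻¹ - 1)) :=
            scalesDet_one_add_single (by simp [hcc])
          refine hE.of_mul (scalesDet_of_pivot_one ih (Finset.univ.erase c) (by simp) _
            (hE.isUnit.mul hA) (hst.one_add_single_mul le_rfl _) ?_ ?_)
          · rw [one_add_single_mul_apply_same, sub_mul, inv_mul_cancel₀ hcc, one_mul,
              add_sub_cancel]
          · intro x hx hxc
            exact absurd (by simp [hxc]) hx
        by_cases hcc : A c c = 0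
        · obtain ⟨i, hci, hi⟩ := exists_ne_zero_below hA hst
          have hic : c ≠ i := by
            rintro rfl
            exact hi hcc
          have hE : ScalesDet (1 + Matrix.single c i 1) :=
            scalesDet_one_add_single (by simp [hic])
          refine hE.of_mul (pivot _ (hE.isUnit.mul hA) (hst.one_add_single_mul hci _) ?_)
          rwa [one_add_single_mul_apply_same, hcc, one_mul, zero_add]
        · exact pivot A hA hst hcc
  exact main n A hA fun x y hy => by omega

/-! ### Invertibility -/

/-- For invertible `A` both sides are the factor by which `A` scales determinants; otherwise both
vanish. -/
theorem mooreDet_mul_conjTranspose_comm (A : Matrix (Fin n) (Fin n) ℍ[ℝ]) :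
    mooreDet (A * Aᴴ) = mooreDet (Aᴴ * A) := by
  by_cases hA : IsUnit A
  · exact (scalesDet_of_isUnit hA).mooreDet_eq_and_ne_zero.1
  · have h1 : mooreDet (A * Aᴴ) = 0 := by
      by_contra h
      exact hA (isUnit_of_mooreDet_mul_conjTranspose_ne_zero h)
    have h2 : mooreDet (Aᴴ * A) = 0 := by
      by_contra h
      rw [← Matrix.conjTranspose_conjTranspose A] at h
      rw [Matrix.conjTranspose_conjTranspose Aᴴ] at h
      have := isUnit_of_mooreDet_mul_conjTranspose_ne_zero h
      exact hA ((isUnit_star (a := A)).1 this)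
    rw [h1, h2]

theorem isUnit_iff_mooreDet_ne_zero : IsUnit A ↔ mooreDet (A * Aᴴ) ≠ 0 :=
  ⟨fun hA => (scalesDet_of_isUnit hA).mooreDet_eq_and_ne_zero.2,
    isUnit_of_mooreDet_mul_conjTranspose_ne_zero⟩

lemma ddet_eq_mooreDet [NeZero n] (A : Matrix (Fin n) (Fin n) ℍ[ℝ]) :
    ddet A = (mooreDet (Aᴴ * A) : ℝ) :=
  rdet_eq_mooreDet (Matrix.isHermitian_conjTranspose_mul_self A) 0

end Hermitian

lemma ring_inverse_eq_of_mul_eq_one {M : Type*} [MonoidWithZero M] {a b : M} (ha : IsUnit a)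
    (h : b * a = 1) : Ring.inverse a = b := by
  rw [← one_mul (Ring.inverse a), ← h, mul_assoc, Ring.mul_inverse_cancel a ha, mul_one]

end QuatDet

theorem theorem8p1 (n : ℕ) [NeZero n] (A : Matrix (Fin n) (Fin n) ℍ[ℝ]) :
    -- the double determinant is well defined and real
    (∀ i : Fin n,
      QuatDet.rdet i (Aᴴ * A) = QuatDet.ddet A ∧ QuatDet.cdet i (Aᴴ * A) = QuatDet.ddet A ∧
      QuatDet.rdet i (A * Aᴴ) = QuatDet.ddet A ∧ QuatDet.cdet i (A * Aᴴ) = QuatDet.ddet A) ∧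
    QuatDet.ddet Aᴴ = QuatDet.ddet A ∧
    (∃ r : ℝ, QuatDet.ddet A = (r : ℍ[ℝ])) ∧
    -- the double cofactors expand it along columns and rows of `A`
    (∀ j : Fin n, QuatDet.ddet A = ∑ i, QuatDet.leftDoubleCofactor A i j * A i j) ∧
    (∀ i : Fin n, QuatDet.ddet A = ∑ j, A i j * QuatDet.rightDoubleCofactor A i j) ∧
    -- the criterion of invertibility
    (IsUnit A ↔ QuatDet.ddet A ≠ 0) ∧
    -- the representations of the inverse
    (QuatDet.ddet A ≠ 0 →
      IsUnit (Aᴴ * A) ∧ IsUnit (A * Aᴴ) ∧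
      Ring.inverse A = Ring.inverse (Aᴴ * A) * Aᴴ ∧
      Ring.inverse A = (QuatDet.ddet A)⁻¹ • (QuatDet.leftDoubleCofactor A)ᵀ ∧
      Ring.inverse A = Aᴴ * Ring.inverse (A * Aᴴ) ∧
      Ring.inverse A = (QuatDet.ddet Aᴴ)⁻¹ • (QuatDet.rightDoubleCofactor A)ᵀ) := by
  have hl := Matrix.isHermitian_conjTranspose_mul_self A
  have hr := Matrix.isHermitian_mul_conjTranspose_self A
  have hcomm := QuatDet.mooreDet_mul_conjTranspose_comm A
  have hd := QuatDet.ddet_eq_mooreDet A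
  set r := QuatDet.mooreDet (Aᴴ * A)
  have hdstar : QuatDet.ddet Aᴴ = QuatDet.ddet A := by
    rw [QuatDet.ddet_eq_mooreDet, Matrix.conjTranspose_conjTranspose, hcomm, hd]
  have hL : (QuatDet.leftDoubleCofactor A)ᵀ * A = r • (1 : Matrix (Fin n) (Fin n) ℍ[ℝ]) :=
    QuatDet.leftDoubleCofactor_transpose_mul A
  have hR : A * (QuatDet.rightDoubleCofactor A)ᵀ = r • (1 : Matrix (Fin n) (Fin n) ℍ[ℝ]) := by
    rw [QuatDet.mul_rightDoubleCofactor_transpose, hcomm]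
  have hunit : IsUnit A ↔ QuatDet.ddet A ≠ 0 := by
    rw [QuatDet.isUnit_iff_mooreDet_ne_zero, hd, hcomm, Ne, Ne, ← Quaternion.coe_zero,
      Quaternion.coe_inj]
  have hentry : ∀ i : Fin n, (r • (1 : Matrix (Fin n) (Fin n) ℍ[ℝ])) i i = QuatDet.ddet A := by
    intro i
    rw [hd, Matrix.smul_apply, Matrix.one_apply_eq, ← Quaternion.coe_mul_eq_smul, mul_one]
  refine ⟨fun i => ⟨?_, ?_, ?_, ?_⟩, hdstar, ⟨_, hd⟩, fun j => ?_, fun i => ?_, hunit,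
    fun h0 => ?_⟩
  · rw [QuatDet.rdet_eq_mooreDet hl, hd]
  · rw [QuatDet.cdet_eq_mooreDet hl, hd]
  · rw [QuatDet.rdet_eq_mooreDet hr, hd, hcomm]
  · rw [QuatDet.cdet_eq_mooreDet hr, hd, hcomm]
  · exact (hentry j).symm.trans (congrFun (congrFun hL j) j).symm
  · exact (hentry i).symm.trans (congrFun (congrFun hR i) i).symm
  · have hA := hunit.2 h0
    have hA' : IsUnit Aᴴ := isUnit_star.2 hA
    have hr0 : r ≠ 0 := fun h => h0 (by rw [hd, h, Quaternion.coe_zero])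
    -- the scalars in the statement are real quaternions, and act as the real numbers do
    have hsmul : ∀ X : Matrix (Fin n) (Fin n) ℍ[ℝ], (QuatDet.ddet A)⁻¹ • X = r⁻¹ • X := by
      intro X
      ext1 x y
      rw [hd, ← Quaternion.coe_inv, Matrix.smul_apply, Matrix.smul_apply, smul_eq_mul,
        Quaternion.coe_mul_eq_smul]
    have hinv : ∀ X : Matrix (Fin n) (Fin n) ℍ[ℝ], X * A = 1 → Ring.inverse A = X :=
      fun X hX => QuatDet.ring_inverse_eq_of_mul_eq_one hA hX
    refine ⟨hA'.mul hA, hA.mul hA', hinv _ ?_, hinv _ ?_, hinv _ ?_, hinv _ ?_⟩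
    · rw [mul_assoc, Ring.inverse_mul_cancel _ (hA'.mul hA)]
    · rw [hsmul, smul_mul_assoc, hL, smul_smul, inv_mul_cancel₀ hr0, one_smul]
    · -- a right inverse of a square matrix over a division ring is a left inverse
      rw [mul_eq_one_comm, ← mul_assoc, Ring.mul_inverse_cancel _ (hA.mul hA')]
    · rw [mul_eq_one_comm, hdstar, hsmul, mul_smul_comm, hR, smul_smul, inv_mul_cancel₀ hr0,
        one_smul]
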